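/- Let $n\ge 0$ be an integer, let $S^n$ be the unit sphere of $\mathbb{R}^{n+1}$, and write $|PQ|=\arccos(P\cdot Q)$ for $P,Q\in S^n$. For $P\in S^n$ let $S^+_P=\{Q\in S^n: P\cdot Q\ge 0\}$ be the closed hemisphere with center $P$ and $S_P=\{Q\in S^n: P\cdot Q=0\}$ its bounding hypersphere. A spherical convex body is a closed set $K\subseteq S^n$ with nonempty interior relative to $S^n$ such that $\{\lambda u:\lambda>0,\ u\in K\}$ is convex in $\mathbb{R}^{n+1}$. The spherical polar set of $K$ is $K^\circ=\bigcap_{P\in K}S^+_P$. A hemisphere $S^+_P$ is a supporting hemisphere of $K$ if $K\subseteq S^+_P$ and $\partial K\cap S_P\neq\emptyset$, where $\partial K$ is the boundary of $K$ in $S^n$. The width of $K$ with respect to a supporting hemisphere $S^+_P$ is $$\mathrm{width}_{S^+_P}(K)=\min\{\pi-|PQ| : Q\in S^n,\ Q\neq\pm P,\ K\subseteq S^+_Q\}.$$ A set $K\subseteq S^n$ is said to be of constant width $\tau$ if it is a spherical convex body and, for every supporting hemisphere $S^+_P$ of $K$, this minimum exists and equals $\tau$. Let $C$ be a spherical convex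 body in $S^n$ and let $0<\tau<\pi$. Then the following two assertions are equivalent: 1. $C$ is of constant width $\tau$; 2. $C^\circ$ is of constant width $\pi-\tau$. -/

import Mathlib

namespace SphGeom

/-- The unit sphere of the `(n+1)`-dimensional Euclidean space, with its subspace topology. Closures,
interiors and frontiers of sets of type `Set (Sph n)` are therefore relative to the sphere. -/
abbrev Sph (n : ℕ) : Type :=
  Metric.sphere (0 : EuclideanSpace ℝ (Fin (n + 1))) 1

/-- The spherical distance `|PQ|`. -/
noncomputable def sdist {n : ℕ} (P Q : Sph n) : ℝ :=
  Real.arccos (inner ℝ (P : EuclideanSpace ℝ (Fin (n + 1))) (Q : EuclideanSpace ℝ (Fin (n + 1))))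

/-- The open-ended cone `{l u : l > 0, u ∈ K}` over a subset of the sphere. -/
def posCone {n : ℕ} (K : Set (Sph n)) : Set (EuclideanSpace ℝ (Fin (n + 1))) :=
  {x | ∃ l : ℝ, 0 < l ∧ ∃ u ∈ K, x = l • (u : EuclideanSpace ℝ (Fin (n + 1)))}

/-- A subset of the sphere is spherically convex if the cone over it is convex. The cone never
contains the origin, so such a set contains no two antipodal points. -/
def IsSphConvex {n : ℕ} (K : Set (Sph n)) : Prop :=
  Convex ℝ (posCone K)

/-- A spherical convex body: closed, spherically convex, with nonempty interior in the sphere. -/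
structure IsSphConvexBody {n : ℕ} (K : Set (Sph n)) : Prop where
  isClosed : IsClosed K
  convex : IsSphConvex K
  nonempty_interior : (interior K).Nonempty

/-- The hypersphere (great subsphere) with center `P`. -/
def hypersphere {n : ℕ} (P : Sph n) : Set (Sph n) :=
  {Q | inner ℝ (P : EuclideanSpace ℝ (Fin (n + 1))) (Q : EuclideanSpace ℝ (Fin (n + 1))) = 0}

/-- The closed hemisphere with center `P`. -/
def hemisphere {n : ℕ} (P : Sph n) : Set (Sph n) :=
  {Q | 0 ≤ inner ℝ (P : EuclideanSpace ℝ (Fin (n + 1))) (Q : EuclideanSpace ℝ (Fin (n + 1)))}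

/-- The spherical polar set. -/
def polar {n : ℕ} (W : Set (Sph n)) : Set (Sph n) :=
  ⋂ P ∈ W, hemisphere P

/-- The hemisphere with center `Q` supports `K` at `P`: it contains `K`, and `P` is a boundary point
of `K` lying on the bounding hypersphere. -/
def SupportsAt {n : ℕ} (K : Set (Sph n)) (Q P : Sph n) : Prop :=
  K ⊆ hemisphere Q ∧ P ∈ frontier K ∩ hypersphere Q

/-- The hemisphere with center `Q` is a supporting hemisphere of `K`. -/
def IsSupporting {n : ℕ} (K : Set (Sph n)) (Q : Sph n) : Prop :=
  ∃ P, SupportsAt K Q P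

/-- The hemispheres with centers `P` and `Q` are different and not opposite, so that their
intersection is a lune. -/
def FormLune {n : ℕ} (P Q : Sph n) : Prop :=
  P ≠ Q ∧ P ≠ -Q

/-- The thickness of the lune cut out by the hemispheres with centers `P` and `Q`. -/
noncomputable def luneThickness {n : ℕ} (P Q : Sph n) : ℝ :=
  Real.pi - sdist P Q

/-- `w` is the width of `K` with respect to the hemisphere with center `P`: the minimum of the
thicknesses of the lunes formed by this hemisphere and a hemisphere that contains `K`.
The minimum is required to be attained. -/
def IsWidth {n : ℕ} (K : Set (Sph n)) (P : Sph n) (w : ℝ) : Prop :=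
  IsLeast {t | ∃ Q, FormLune P Q ∧ K ⊆ hemisphere Q ∧ t = luneThickness P Q} w

/-- `K` is a spherical convex body of constant width `τ`: its width with respect to every
supporting hemisphere is `τ`. -/
def IsConstantWidth {n : ℕ} (K : Set (Sph n)) (τ : ℝ) : Prop :=
  IsSphConvexBody K ∧ ∀ P, IsSupporting K P → IsWidth K P τ

end SphGeom

/-! Let V be a spherical convex body and W its polar. The centres of the supporting hemispheres of V
are the points p of W orthogonal to some x in V. Taking cosines, V has constant width τ iff at each
such p the minimum of ⟪p, q⟫ over q in W is c = -cos τ, which is `BoundaryMin W V c`: W has constant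
diameter π - τ. The theorem becomes `BoundaryMin W V c ↔ BoundaryMin V W (-c)`. Exchanging W and V
flips the sign of c, so two implications suffice.

Forward, c ≥ 0: W is complete (`PolarPair.mem_of_forall_le`), so from p the direction x leads to a
diameter endpoint c p + s x in W, where c² + s² = 1 (`PolarPair.diameter_endpoint_mem`).
Nonnegativity of y ∈ V at this endpoint forces ⟪x, y⟫ ≥ -c.

Backward, c > 0: for a diametral pair P, Q of W, the tangent direction at P towards Q lies in V
(`PolarPair.smul_sub_mem`). The width hypothesis in that direction bounds the diameter. -/

namespace SphGeom

/-! ### Polar pairs of sets of unit vectors and first-order conditions. -/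

section PolarPair

variable {E : Type*} [NormedAddCommGroup E] [InnerProductSpace ℝ E]

local notation "⟪" x ", " y "⟫" => inner ℝ x y

/-- One half of the duality between two sets of unit vectors: `W` is compact, it is the polar
of `V` in the unit sphere, and it has a point at which all elements of `V` are positive. -/
structure IsPolarOf (W V : Set E) : Prop where
  isCompact : IsCompact W
  norm_eq : ∀ w ∈ W, ‖w‖ = 1
  nonneg : ∀ w ∈ W, ∀ v ∈ V, 0 ≤ ⟪w, v⟫
  mem : ∀ x : E, ‖x‖ = 1 → (∀ v ∈ V, 0 ≤ ⟪x, v⟫) → x ∈ W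
  exists_pos : ∃ e ∈ W, ∀ v ∈ V, 0 < ⟪e, v⟫

/-- Two sets of unit vectors that are polar to each other. -/
structure PolarPair (W V : Set E) : Prop where
  left : IsPolarOf W V
  right : IsPolarOf V W

/-- At every point `p` of `W` which is orthogonal to some element of `V`, the minimum of the inner
product of `p` with the points of `W` is `c`. -/
def BoundaryMin (W V : Set E) (c : ℝ) : Prop :=
  ∀ p ∈ W, ∀ x ∈ V, ⟪p, x⟫ = 0 → (∀ q ∈ W, c ≤ ⟪p, q⟫) ∧ ∃ q ∈ W, ⟪p, q⟫ = c

theorem PolarPair.symm {W V : Set E} (h : PolarPair W V) : PolarPair V W := ⟨h.2, h.1⟩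

theorem IsPolarOf.smul_mem {W V : Set E} (h : IsPolarOf W V) {x : E} (hx : x ≠ 0)
    (hv : ∀ v ∈ V, 0 ≤ ⟪x, v⟫) : ‖x‖⁻¹ • x ∈ W := by
  refine h.mem _ (norm_smul_inv_norm hx) fun v hvV => ?_
  rw [real_inner_smul_left]
  exact mul_nonneg (by positivity) (hv v hvV)

/-- First-order condition for the minimum of a linear functional over a polar set. -/
theorem IsPolarOf.first_variation {W V : Set E} (h : IsPolarOf W V) {p q z : E} (hp : p ∈ W)
    (hz : z ∈ W) (hmin : ∀ r ∈ W, ⟪q, p⟫ ≤ ⟪q, r⟫) : 0 ≤ ⟪q - ⟪q, p⟫ • p, z⟫ := by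
  have hp1 := h.norm_eq p hp
  have hz1 := h.norm_eq z hz
  have hpp : ⟪p, p⟫ = 1 := by rw [real_inner_self_eq_norm_sq, hp1]; norm_num
  have hzz : ⟪z, z⟫ = 1 := by rw [real_inner_self_eq_norm_sq, hz1]; norm_num
  set m := ⟪q, p⟫ with hm
  -- Minimality of `p` against the normalization of `p + t • z`, which is again in `W`.
  have key : ∀ t : ℝ, 0 < t → m * ‖p + t • z‖ ≤ m + t * ⟪q, z⟫ := by
    intro t ht
    by_cases h0 : p + t • z = 0
    · have h1 : ⟪q, p + t • z⟫ = 0 := by rw [h0, inner_zero_right]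
      rw [inner_add_right, real_inner_smul_right] at h1
      rw [h0, norm_zero]
      linarith
    · have hmem : ‖p + t • z‖⁻¹ • (p + t • z) ∈ W := by
        refine h.smul_mem h0 fun v hv => ?_
        rw [inner_add_left, real_inner_smul_left]
        have := h.nonneg p hp v hv
        have := h.nonneg z hz v hv
        positivity
      have h1 := hmin _ hmem
      have hpos : 0 < ‖p + t • z‖ := norm_pos_iff.mpr h0
      rw [real_inner_smul_right, inner_add_right, real_inner_smul_right, inv_mul_eq_div,
        le_div_iff₀ hpos] at h1
      linarith
  have hsq : ∀ t : ℝ, ‖p + t • z‖ ^ 2 = 1 + 2 * t * ⟪p, z⟫ + t ^ 2 := by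
    intro t
    rw [norm_add_sq_real, hp1, norm_smul, hz1, real_inner_smul_right, mul_one,
      Real.norm_eq_abs, sq_abs]
    ring
  rw [inner_sub_left, real_inner_smul_left]
  -- For `m ≥ 0` the lower bound ‖p + z‖ ≥ 1 + ⟪p, z⟫ suffices. For `m < 0` an upper bound on the
  -- norm, exact to first order in `t`, is needed.
  rcases le_or_gt 0 m with hm0 | hm0
  · have h1 := key 1 one_pos
    have h2 : ⟪p, p + (1 : ℝ) • z⟫ ≤ ‖p‖ * ‖p + (1 : ℝ) • z‖ := real_inner_le_norm _ _
    rw [hp1, one_mul, one_smul, inner_add_right, hpp] at h2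
    rw [one_smul] at h1
    nlinarith
  · by_contra hneg
    push Not at hneg
    set d := ⟪q, z⟫ - m * ⟪p, z⟫ with hd
    have hlin : ∀ t : ℝ, 0 < t → m * t / 2 ≤ d := by
      intro t ht
      have hn : ‖p + t • z‖ ≤ 1 + t * ⟪p, z⟫ + t ^ 2 / 2 := by
        nlinarith [hsq t, sq_nonneg (‖p + t • z‖ - 1)]
      have := key t ht
      have h3 : m * (1 + t * ⟪p, z⟫ + t ^ 2 / 2) ≤ m * ‖p + t • z‖ :=
        mul_le_mul_of_nonpos_left hn hm0.le
      have h4 : t * (m * t / 2) ≤ t * d := by rw [hd]; nlinarith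
      exact le_of_mul_le_mul_left h4 ht
    -- This `t` turns the bound into d / 2 ≤ d, impossible for negative `d`.
    have := hlin (d / m) (div_pos_of_neg_of_neg hneg hm0)
    rw [mul_div_cancel₀ _ hm0.ne] at this
    linarith

theorem PolarPair.neg_one_lt_inner {W V : Set E} (h : PolarPair W V) {p q : E} (hp : p ∈ W)
    (hq : q ∈ W) : -1 < ⟪p, q⟫ := by
  obtain ⟨e, -, he⟩ := h.right.exists_pos
  have hp1 := h.left.norm_eq p hp
  have hq1 := h.left.norm_eq q hq
  by_contra hle
  push Not at hle
  have h0 : ‖p + q‖ ^ 2 ≤ 0 := by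
    rw [norm_add_sq_real, hp1, hq1]
    linarith
  have h1 : p + q = 0 := by
    rw [← norm_eq_zero]
    exact pow_eq_zero_iff two_ne_zero |>.mp (le_antisymm h0 (sq_nonneg _))
  have h2 : ⟪e, p + q⟫ = 0 := by rw [h1, inner_zero_right]
  rw [inner_add_right] at h2
  linarith [he p hp, he q hq]

theorem norm_sub_inner_smul_sq {p q : E} (hp : ‖p‖ = 1) (hq : ‖q‖ = 1) :
    ‖q - ⟪q, p⟫ • p‖ ^ 2 = 1 - ⟪q, p⟫ ^ 2 := by
  rw [norm_sub_sq_real, norm_smul, hp, hq, real_inner_smul_right, mul_one, Real.norm_eq_abs,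
    sq_abs]
  ring

theorem norm_sub_inner_smul {p q : E} (hp : ‖p‖ = 1) (hq : ‖q‖ = 1) :
    ‖q - ⟪q, p⟫ • p‖ = √(1 - ⟪q, p⟫ ^ 2) := by
  rw [← norm_sub_inner_smul_sq hp hq, Real.sqrt_sq (norm_nonneg _)]

/-- The normalized orthogonal component of `q` with respect to `p`, where `p` is a nearest point to
the antipode of `q`, belongs to the polar set. -/
theorem PolarPair.smul_sub_mem {W V : Set E} (h : PolarPair W V) {p q : E} (hp : p ∈ W)
    (hq : q ∈ W) (hlt : ⟪q, p⟫ < 1) (hmin : ∀ r ∈ W, ⟪q, p⟫ ≤ ⟪q, r⟫) :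
    (√(1 - ⟪q, p⟫ ^ 2))⁻¹ • (q - ⟪q, p⟫ • p) ∈ V := by
  have hnorm := norm_sub_inner_smul (h.left.norm_eq p hp) (h.left.norm_eq q hq)
  rw [← hnorm]
  refine h.right.smul_mem ?_ fun z hz => h.left.first_variation hp hz hmin
  rw [← norm_pos_iff, hnorm, Real.sqrt_pos]
  nlinarith [h.neg_one_lt_inner hq hp]

/-- A pair of points of `W` at maximal distance. -/
theorem IsPolarOf.exists_min {W V : Set E} (h : IsPolarOf W V) :
    ∃ p ∈ W, ∃ q ∈ W, ∀ a ∈ W, ∀ b ∈ W, ⟪q, p⟫ ≤ ⟪a, b⟫ := by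
  obtain ⟨e, he, -⟩ := h.exists_pos
  obtain ⟨⟨q, p⟩, ⟨hq, hp⟩, hmin⟩ := (h.isCompact.prod h.isCompact).exists_isMinOn ⟨(e, e), he, he⟩
    (f := fun x : E × E => (⟪x.1, x.2⟫ : ℝ)) (by fun_prop)
  exact ⟨p, hp, q, hq, fun a ha b hb => hmin (Set.mk_mem_prod ha hb)⟩

theorem inner_smul_sub_inner_smul {p q : E} (k : ℝ) (hp : ‖p‖ = 1) :
    ⟪p, k • (q - ⟪q, p⟫ • p)⟫ = 0 := by
  rw [real_inner_smul_right, inner_sub_right, real_inner_smul_right, real_inner_self_eq_norm_sq,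
    hp, real_inner_comm]
  ring

/-- If all boundary points have the same minimal inner product, then it is the minimum over all
pairs of points. -/
theorem PolarPair.le_inner {W V : Set E} (h : PolarPair W V) {c : ℝ} (hc : c < 1)
    (hW : BoundaryMin W V c) {p x : E} (hp : p ∈ W) (hx : x ∈ V) (hpx : ⟪p, x⟫ = 0)
    {a b : E} (ha : a ∈ W) (hb : b ∈ W) : c ≤ ⟪a, b⟫ := by
  obtain ⟨P, hP, Q, hQ, hmin⟩ := h.left.exists_min
  obtain ⟨-, q, hq, hpq⟩ := hW p hp x hx hpx
  have hlt : ⟪Q, P⟫ < 1 := (hmin p hp q hq).trans_lt (hpq ▸ hc)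
  have hX := h.smul_sub_mem hP hQ hlt fun r hr => hmin Q hQ r hr
  have h1 := (hW P hP _ hX (inner_smul_sub_inner_smul _ (h.left.norm_eq P hP))).1 Q hQ
  rw [real_inner_comm] at h1
  exact h1.trans (hmin a ha b hb)

/-! ### Constant diameter versus constant width. -/

/-- Completeness: a unit vector whose distance from all points of `W` is at most the diameter of
`W` belongs to `W`. -/
theorem PolarPair.mem_of_forall_le {W V : Set E} (h : PolarPair W V) {c : ℝ} (hc0 : 0 ≤ c)
    (hc : c < 1) (hW : BoundaryMin W V c) {p x : E} (hp : p ∈ W) (hx : x ∈ V) (hpx : ⟪p, x⟫ = 0)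
    {z : E} (hz : ‖z‖ = 1) (hzW : ∀ q ∈ W, c ≤ ⟪z, q⟫) : z ∈ W := by
  by_contra hzn
  obtain ⟨v', hv', hneg⟩ : ∃ v ∈ V, ⟪z, v⟫ < 0 := by
    by_contra! hcon
    exact hzn (h.left.mem z hz hcon)
  obtain ⟨e, he, hepos⟩ := h.left.exists_pos
  have he1 := h.left.norm_eq e he
  -- `v` is the last constraint to become nonnegative along the ray from `z` in direction `e`; hence
  -- `z + μ • e` is where the ray enters the cone over `W`.
  obtain ⟨v, hv, hmax⟩ := h.right.isCompact.exists_isMinOn ⟨v', hv'⟩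
    (f := fun v : E => (⟪z, v⟫ / ⟪e, v⟫ : ℝ))
    (ContinuousOn.div (by fun_prop) (by fun_prop) fun v hv => (hepos v hv).ne')
  set μ := -(⟪z, v⟫ / ⟪e, v⟫) with hμ
  have hμ0 : 0 < μ := by
    have h1 : ⟪z, v⟫ / ⟪e, v⟫ ≤ ⟪z, v'⟫ / ⟪e, v'⟫ := hmax hv'
    have h2 := div_neg_of_neg_of_pos hneg (hepos v' hv')
    linarith
  have hy : z + μ • e ≠ 0 := by
    intro h0
    have h1 : ⟪z + μ • e, e⟫ = 0 := by rw [h0, inner_zero_left]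
    rw [inner_add_left, real_inner_smul_left, real_inner_self_eq_norm_sq, he1] at h1
    nlinarith [hzW e he]
  have hyV : ∀ u ∈ V, 0 ≤ ⟪z + μ • e, u⟫ := by
    intro u hu
    have h1 : ⟪z, v⟫ / ⟪e, v⟫ ≤ ⟪z, u⟫ / ⟪e, u⟫ := hmax hu
    rw [le_div_iff₀ (hepos u hu)] at h1
    rw [inner_add_left, real_inner_smul_left, hμ]
    linarith
  have hyv : ⟪z + μ • e, v⟫ = 0 := by
    rw [inner_add_left, real_inner_smul_left, hμ, neg_mul, div_mul_cancel₀ _ (hepos v hv).ne']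
    ring
  have hyW := h.left.smul_mem hy hyV
  obtain ⟨-, q, hq, hyq⟩ := hW _ hyW v hv (by rw [real_inner_smul_left, hyv, mul_zero])
  have hyn : 0 < ‖z + μ • e‖ := norm_pos_iff.mpr hy
  rw [real_inner_smul_left, inv_mul_eq_div, div_eq_iff hyn.ne', inner_add_left,
    real_inner_smul_left] at hyq
  -- With equality, `e` would minimize ⟪q, ·⟫ on `W`, and `V` would contain a vector orthogonal to
  -- `e`.
  have heq : c < ⟪q, e⟫ := by
    refine lt_of_le_of_ne (h.le_inner hc hW hp hx hpx hq he) fun hce => ?_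
    have hX := h.smul_sub_mem he hq (hce ▸ hc) fun r hr =>
      hce ▸ h.le_inner hc hW hp hx hpx hq hr
    exact (hepos _ hX).ne' (inner_smul_sub_inner_smul _ he1)
  rw [real_inner_comm] at heq
  have htri : ‖z + μ • e‖ ≤ 1 + μ := by
    refine (norm_add_le _ _).trans ?_
    rw [norm_smul, hz, he1, Real.norm_eq_abs, abs_of_pos hμ0, mul_one]
  nlinarith [hzW q hq, mul_le_mul_of_nonneg_left htri hc0, mul_lt_mul_of_pos_left heq hμ0]

/-- For a set of constant diameter at most a quarter circle, each supporting functional `x` at `p`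
is the direction of a diameter issuing from `p`. -/
theorem PolarPair.diameter_endpoint_mem {W V : Set E} (h : PolarPair W V) {c s : ℝ} (hc0 : 0 ≤ c)
    (hs : 0 < s) (hcs : c ^ 2 + s ^ 2 = 1) (hW : BoundaryMin W V c) {p x : E} (hp : p ∈ W)
    (hx : x ∈ V) (hpx : ⟪p, x⟫ = 0) : c • p + s • x ∈ W := by
  have hc : c < 1 := by nlinarith
  have hp1 := h.left.norm_eq p hp
  have hx1 := h.right.norm_eq x hx
  have hxp : ⟪x, p⟫ = 0 := by rw [real_inner_comm, hpx]
  refine h.mem_of_forall_le hc0 hc hW hp hx hpx ?_ fun z hz => ?_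
  · rw [← sq_eq_sq₀ (norm_nonneg _) zero_le_one, norm_add_sq_real, norm_smul, norm_smul,
      real_inner_smul_left, real_inner_smul_right, hpx, hp1, hx1, Real.norm_eq_abs,
      Real.norm_eq_abs, mul_one, mul_one, sq_abs, sq_abs]
    linarith
  · by_contra! hlt
    rw [inner_add_left, real_inner_smul_left, real_inner_smul_left] at hlt
    have hz1 := h.left.norm_eq z hz
    set k := 1 - ⟪p, z⟫ with hk
    set a := ⟪x, z⟫ with ha
    have ha0 : 0 ≤ a := h.right.nonneg x hx z hz
    have hak : s * a < c * k := by rw [hk]; linarith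
    have hk0 : 0 < k := by
      by_contra! hk0
      nlinarith [mul_nonneg hs.le ha0, mul_nonneg hc0 (neg_nonneg.mpr hk0)]
    -- There is room for `g` strictly between a and c k / s. The first inequality pushes `r` below
    -- to the negative side of `x`; the second keeps `r` within the diameter bound for small `ε`.
    obtain ⟨g, hag, hgk⟩ : ∃ g, a < g ∧ s * g < c * k :=
      ⟨(a + c * k / s) / 2, by
        have : a < c * k / s := by rw [lt_div_iff₀ hs]; linarith
        linarith, by
        have : s * (c * k / s) = c * k := mul_div_cancel₀ _ hs.ne'
        nlinarith⟩
    have hg0 : 0 < g := ha0.trans_lt hag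
    obtain ⟨ε, hε0, hε1, hε⟩ : ∃ ε : ℝ, 0 < ε ∧ ε ≤ 1 ∧ c * ε * (k + g ^ 2 / 2) ≤ c * k - s * g := by
      have hA : 0 < k + g ^ 2 / 2 := by positivity
      refine ⟨min 1 ((c * k - s * g) / (k + g ^ 2 / 2)), lt_min one_pos (div_pos (by linarith) hA),
        min_le_left _ _, ?_⟩
      have h1 : min 1 ((c * k - s * g) / (k + g ^ 2 / 2)) * (k + g ^ 2 / 2) ≤ c * k - s * g := by
        rw [← le_div_iff₀ hA]
        exact min_le_right _ _
      have h2 : 0 ≤ min 1 ((c * k - s * g) / (k + g ^ 2 / 2)) * (k + g ^ 2 / 2) :=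
        mul_nonneg (le_min zero_le_one (div_nonneg (by linarith) hA.le)) hA.le
      nlinarith
    set r := (1 - ε) • p + ε • z - (ε * g) • x with hr
    have hinner : ∀ w : E, ⟪r, w⟫ = (1 - ε) * ⟪p, w⟫ + ε * ⟪z, w⟫ - ε * g * ⟪x, w⟫ := by
      intro w
      simp only [hr, inner_sub_left, inner_add_left, real_inner_smul_left]
    have hpz : ⟪p, z⟫ = 1 - k := by rw [hk]; ring
    have hrx : ⟪r, x⟫ < 0 := by
      rw [hinner, hpx, real_inner_comm x z, ← ha, real_inner_self_eq_norm_sq, hx1]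
      nlinarith
    have hr0 : r ≠ 0 := by
      intro h0
      rw [h0, inner_zero_left] at hrx
      exact lt_irrefl _ hrx
    have hrn : 0 < ‖r‖ := norm_pos_iff.mpr hr0
    have hrsq : ‖r‖ ^ 2 = 1 - 2 * ε * (1 - ε) * k - 2 * ε ^ 2 * g * a + ε ^ 2 * g ^ 2 := by
      rw [← real_inner_self_eq_norm_sq, hinner, real_inner_comm r p, real_inner_comm r z,
        real_inner_comm r x, hinner, hinner, hinner, real_inner_comm p z, real_inner_comm x z, hpz,
        hpx, hxp, ← ha, real_inner_self_eq_norm_sq, real_inner_self_eq_norm_sq,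
        real_inner_self_eq_norm_sq, hp1, hz1, hx1]
      ring
    -- From ‖r‖ ≤ (1 + ‖r‖²) / 2; its ε² coefficient dictated the choice of `ε`.
    have hrle : ‖r‖ ≤ 1 - ε * k + ε ^ 2 * (k + g ^ 2 / 2) := by
      nlinarith [sq_nonneg (‖r‖ - 1), mul_nonneg (mul_nonneg (sq_nonneg ε) hg0.le) ha0]
    have hrW : ‖r‖⁻¹ • r ∈ W := by
      refine h.mem_of_forall_le hc0 hc hW hp hx hpx (norm_smul_inv_norm hr0) fun w hw => ?_
      rw [real_inner_smul_left, inv_mul_eq_div, le_div_iff₀ hrn, hinner]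
      have hpw := h.le_inner hc hW hp hx hpx hp hw
      have hzw := h.le_inner hc hW hp hx hpx hz hw
      have hxw : ⟪x, w⟫ ≤ s := by
        have hw1 := h.left.norm_eq w hw
        have h1 := real_inner_le_norm x (w - ⟪w, p⟫ • p)
        have h2 := norm_sub_inner_smul_sq hp1 hw1
        rw [inner_sub_right, real_inner_smul_right, hxp, mul_zero, sub_zero, hx1, one_mul] at h1
        refine h1.trans ?_
        rw [← sq_le_sq₀ (norm_nonneg _) hs.le, h2, real_inner_comm]
        nlinarith
      have h1 : ε * g * ⟪x, w⟫ ≤ ε * g * s := mul_le_mul_of_nonneg_left hxw (by positivity)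
      have h2 : (1 - ε) * c ≤ (1 - ε) * ⟪p, w⟫ := mul_le_mul_of_nonneg_left hpw (by linarith)
      have h3 : ε * c ≤ ε * ⟪z, w⟫ := mul_le_mul_of_nonneg_left hzw hε0.le
      have h4 := mul_le_mul_of_nonneg_left hrle hc0
      have h5 := mul_le_mul_of_nonneg_left hε hε0.le
      linarith
    have h1 := h.left.nonneg _ hrW x hx
    rw [real_inner_smul_left] at h1
    exact absurd h1 (not_le.mpr (mul_neg_of_pos_of_neg (by positivity) hrx))

/-- Constant diameter at most a quarter circle implies constant width. -/
theorem PolarPair.boundaryMin_symm_of_nonneg {W V : Set E} (h : PolarPair W V) {c : ℝ}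
    (hc0 : 0 ≤ c) (hc : c < 1) (hW : BoundaryMin W V c) : BoundaryMin V W (-c) := by
  intro x hx p hp hxp
  have hpx : ⟪p, x⟫ = 0 := by rw [real_inner_comm, hxp]
  have hp1 := h.left.norm_eq p hp
  have hx1 := h.right.norm_eq x hx
  set s := √(1 - c ^ 2) with hs'
  have hs : 0 < s := Real.sqrt_pos.mpr (by nlinarith)
  have hs2 : s ^ 2 = 1 - c ^ 2 := Real.sq_sqrt (by nlinarith)
  have hq := h.diameter_endpoint_mem hc0 hs (by linarith) hW hp hx hpx
  have hpq : ⟪p, c • p + s • x⟫ = c := by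
    rw [inner_add_right, real_inner_smul_right, real_inner_smul_right, hpx,
      real_inner_self_eq_norm_sq, hp1]
    ring
  constructor
  · intro y hy
    have hy1 := h.right.norm_eq y hy
    have h1 := h.right.nonneg y hy _ hq
    rw [inner_add_right, real_inner_smul_right, real_inner_smul_right] at h1
    have h2 := norm_sub_inner_smul_sq hx1 hy1
    have h3 := real_inner_le_norm p (y - ⟪y, x⟫ • x)
    rw [inner_sub_right, real_inner_smul_right, hpx, mul_zero, sub_zero, hp1, one_mul,
      real_inner_comm] at h3
    have h4 : 0 ≤ ⟪y, p⟫ := h.right.nonneg y hy p hp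
    rw [real_inner_comm]
    -- If ⟪x, y⟫ < -c, the endpoint forces ⟪y, p⟫ > s, while the component of `y` orthogonal to `x`
    -- has norm below s.
    by_contra! hlt
    have h5 : s * c < c * ⟪y, p⟫ := by nlinarith
    have h6 : s < ⟪y, p⟫ := lt_of_mul_lt_mul_left (by linarith) hc0
    nlinarith
  · have hX := h.smul_sub_mem hq hp (by rwa [hpq]) fun r hr => by
      rw [hpq]
      exact h.le_inner hc hW hp hx hpx hp hr
    refine ⟨_, hX, ?_⟩
    rw [hpq, ← hs', real_inner_smul_right, inner_sub_right, real_inner_smul_right, inner_add_right,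
      real_inner_smul_right, real_inner_smul_right, hxp, real_inner_self_eq_norm_sq, hx1]
    field_simp
    ring

/-- Constant width less than a quarter circle implies constant diameter. -/
theorem PolarPair.boundaryMin_of_symm {W V : Set E} (h : PolarPair W V) {c : ℝ}
    (hc0 : 0 < c) (hc : c < 1) (hV : BoundaryMin V W (-c)) : BoundaryMin W V c := by
  set s := √(1 - c ^ 2) with hs'
  have hs : 0 < s := Real.sqrt_pos.mpr (by nlinarith)
  have hs2 : s ^ 2 = 1 - c ^ 2 := Real.sq_sqrt (by nlinarith)
  have bound : ∀ p ∈ W, ∀ x ∈ V, ∀ y ∈ V, ⟪p, x⟫ = 0 → ⟪x, y⟫ = -c → ⟪p, y⟫ ≤ s := by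
    intro p hp x hx y hy hpx hxy
    have h2 := norm_sub_inner_smul (h.right.norm_eq x hx) (h.right.norm_eq y hy)
    have h3 := real_inner_le_norm p (y - ⟪y, x⟫ • x)
    rw [h2, inner_sub_right, real_inner_smul_right, hpx, mul_zero, sub_zero, h.left.norm_eq p hp,
      one_mul, real_inner_comm x y, hxy, neg_sq, ← hs'] at h3
    exact h3
  have diam : ∀ a ∈ W, ∀ b ∈ W, c ≤ ⟪a, b⟫ := by
    obtain ⟨P, hP, Q, hQ, hmin⟩ := h.left.exists_min
    suffices hm : c ≤ ⟪Q, P⟫ from fun a ha b hb => hm.trans (hmin a ha b hb)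
    by_contra! hlt
    have hP1 := h.left.norm_eq P hP
    have hX := h.smul_sub_mem hP hQ (hlt.trans hc) fun r hr => hmin Q hQ r hr
    set m := ⟪Q, P⟫ with hm
    have hm1 : -1 < m := h.neg_one_lt_inner hQ hP
    set η := √(1 - m ^ 2) with hη'
    have hη : 0 < η := Real.sqrt_pos.mpr (by nlinarith)
    have hη2 : η ^ 2 = 1 - m ^ 2 := Real.sq_sqrt (by nlinarith)
    have hPX := inner_smul_sub_inner_smul (p := P) (q := Q) η⁻¹ hP1
    rw [← hm] at hPX
    set X := η⁻¹ • (Q - m • P) with hXdef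
    have hQX : Q = m • P + η • X := by
      rw [hXdef, smul_inv_smul₀ hη.ne']
      abel
    -- Nonnegativity of `Y` at Q = m P + η X gives η c ≤ m s, hence c ≤ m after squaring.
    obtain ⟨-, Y, hY, hXY⟩ := hV X hX P hP (by rw [real_inner_comm, hPX])
    have h1 := h.left.nonneg Q hQ Y hY
    rw [hQX, inner_add_left, real_inner_smul_left, real_inner_smul_left, hXY] at h1
    have h2 := h.left.nonneg P hP Y hY
    have h3 := bound P hP X hX Y hY hPX hXY
    have h4 : 0 < m := by
      by_contra! hm0
      nlinarith [mul_pos hη hc0]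
    have h5 : η * c ≤ m * s := by nlinarith
    have h6 : (η * c) ^ 2 ≤ (m * s) ^ 2 := pow_le_pow_left₀ (by positivity) h5 2
    rw [mul_pow, mul_pow, hη2, hs2] at h6
    nlinarith
  intro p hp x hx hpx
  refine ⟨fun q hq => diam p hp q hq, ?_⟩
  obtain ⟨hle, y, hy, hxy⟩ := hV x hx p hp (by rw [real_inner_comm, hpx])
  -- The diameter partner of `p` is the normalization of x + c y.
  have hb := h.symm.smul_sub_mem hy hx (by rw [hxy]; linarith) (by rw [hxy]; exact hle)
  rw [hxy, neg_sq, ← hs'] at hb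
  refine ⟨_, hb, le_antisymm ?_ (diam p hp _ hb)⟩
  have h1 := bound p hp x hx y hy hpx hxy
  rw [real_inner_smul_right, inner_sub_right, real_inner_smul_right, hpx, inv_mul_eq_div,
    div_le_iff₀ hs]
  nlinarith

theorem PolarPair.boundaryMin_symm {W V : Set E} (h : PolarPair W V) {c : ℝ} (hc1 : -1 < c)
    (hc : c < 1) (hW : BoundaryMin W V c) : BoundaryMin V W (-c) := by
  rcases le_or_gt 0 c with hc0 | hc0
  · exact h.boundaryMin_symm_of_nonneg hc0 hc hW
  · exact h.symm.boundaryMin_of_symm (by linarith) (by linarith) (by rwa [neg_neg])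

theorem PolarPair.boundaryMin_iff {W V : Set E} (h : PolarPair W V) {c : ℝ} (hc1 : -1 < c)
    (hc : c < 1) : BoundaryMin W V c ↔ BoundaryMin V W (-c) :=
  ⟨h.boundaryMin_symm hc1 hc, fun hV => by
    simpa using h.symm.boundaryMin_symm (by linarith) (by linarith) hV⟩

end PolarPair

end SphGeom
namespace SphGeom

/-! ### Spherical convex bodies and the bipolar theorem. -/

section Bodies

variable {n : ℕ}

local notation "⟪" x ", " y "⟫" => inner ℝ x y

local notation "𝔼" n => EuclideanSpace ℝ (Fin (n + 1))

theorem mem_polar {W : Set (Sph n)} {Q : Sph n} :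
    Q ∈ polar W ↔ ∀ P ∈ W, 0 ≤ ⟪(Q : 𝔼 n), (P : 𝔼 n)⟫ := by
  simp only [polar, hemisphere, Set.mem_iInter, Set.mem_ofPred_eq]
  exact forall₂_congr fun P _ => by rw [real_inner_comm]

theorem subset_hemisphere_iff {K : Set (Sph n)} {Q : Sph n} : K ⊆ hemisphere Q ↔ Q ∈ polar K :=
  mem_polar.symm

theorem isClosed_polar (W : Set (Sph n)) : IsClosed (polar W) := by
  have : polar W = ⋂ P ∈ W, {Q : Sph n | 0 ≤ ⟪(P : 𝔼 n), (Q : 𝔼 n)⟫} := rfl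
  rw [this]
  exact isClosed_biInter fun P _ => isClosed_le continuous_const (by fun_prop)

theorem norm_sph (P : Sph n) : ‖(P : 𝔼 n)‖ = 1 := norm_eq_of_mem_sphere P

theorem ne_zero_of_mem_posCone {K : Set (Sph n)} {x : 𝔼 n} (hx : x ∈ posCone K) : x ≠ 0 := by
  obtain ⟨l, hl, u, -, rfl⟩ := hx
  exact smul_ne_zero hl.ne' (ne_zero_of_mem_unit_sphere u)

theorem coe_mem_posCone {K : Set (Sph n)} {P : Sph n} (hP : P ∈ K) : (P : 𝔼 n) ∈ posCone K :=
  ⟨1, one_pos, P, hP, (one_smul _ _).symm⟩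

/-- The normalization of a nonzero vector. -/
noncomputable def toSph (x : 𝔼 n) (hx : x ≠ 0) : Sph n :=
  ⟨‖x‖⁻¹ • x, by simpa using norm_smul_inv_norm (𝕜 := ℝ) hx⟩

theorem coe_toSph (x : 𝔼 n) (hx : x ≠ 0) : (toSph x hx : 𝔼 n) = ‖x‖⁻¹ • x := rfl

theorem mem_posCone_iff {K : Set (Sph n)} {x : 𝔼 n} (hx : x ≠ 0) :
    x ∈ posCone K ↔ toSph x hx ∈ K := by
  constructor
  · rintro ⟨l, hl, u, hu, rfl⟩
    convert hu
    ext1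
    rw [coe_toSph, norm_smul, norm_sph, mul_one, Real.norm_eq_abs, abs_of_pos hl,
      inv_smul_smul₀ hl.ne']
  · intro h
    exact ⟨‖x‖, norm_pos_iff.mpr hx, _, h, by
      rw [coe_toSph, smul_inv_smul₀ (norm_ne_zero_iff.mpr hx)]⟩

/-- Otherwise moving `P` slightly in direction `-Q` and renormalizing stays in `K` but makes the
inner product with `Q` negative. -/
theorem pos_of_mem_interior {K : Set (Sph n)} {P Q : Sph n} (hP : P ∈ interior K)
    (hQ : Q ∈ polar K) : 0 < ⟪(P : 𝔼 n), (Q : 𝔼 n)⟫ := by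
  rw [mem_polar] at hQ
  by_contra! hle
  have hlt : ∀ t : ℝ, 0 < t → ⟪(P : 𝔼 n) - t • (Q : 𝔼 n), (Q : 𝔼 n)⟫ < 0 := by
    intro t ht
    rw [inner_sub_left, real_inner_smul_left, real_inner_self_eq_norm_sq, norm_sph]
    linarith
  have hne : ∀ t : ℝ, 0 < t → (P : 𝔼 n) - t • (Q : 𝔼 n) ≠ 0 := by
    intro t ht h0
    have := hlt t ht
    rw [h0, inner_zero_left] at this
    exact lt_irrefl _ this
  obtain ⟨U, hU, hUK⟩ := mem_nhds_subtype _ _ _ |>.mp (mem_interior_iff_mem_nhds.mp hP)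
  have hsub : ContinuousAt (fun t : ℝ => (P : 𝔼 n) - t • (Q : 𝔼 n)) 0 := by fun_prop
  have hcont : ContinuousAt (fun t : ℝ => ‖(P : 𝔼 n) - t • (Q : 𝔼 n)‖⁻¹ •
      ((P : 𝔼 n) - t • (Q : 𝔼 n))) 0 :=
    (hsub.norm.inv₀ (by simp)).smul hsub
  have htend : ∀ᶠ t : ℝ in nhds 0, ‖(P : 𝔼 n) - t • (Q : 𝔼 n)‖⁻¹ •
      ((P : 𝔼 n) - t • (Q : 𝔼 n)) ∈ U := by
    apply hcont
    simpa [norm_sph] using hU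
  obtain ⟨t, htU, ht⟩ := ((htend.filter_mono nhdsWithin_le_nhds).and
    (self_mem_nhdsWithin : Set.Ioi (0 : ℝ) ∈ nhdsWithin 0 (Set.Ioi 0))).exists
  have hmem : toSph _ (hne t ht) ∈ K := hUK htU
  have h1 := hQ _ hmem
  rw [real_inner_comm, coe_toSph, real_inner_smul_left] at h1
  exact absurd h1 (not_le.mpr (mul_neg_of_pos_of_neg
    (inv_pos.mpr (norm_pos_iff.mpr (hne t ht))) (hlt t ht)))

theorem isClosed_posCone_union {K : Set (Sph n)} (hK : IsClosed K) :
    IsClosed (posCone K ∪ {0}) := by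
  rw [← isOpen_compl_iff, isOpen_iff_mem_nhds]
  intro x hx
  simp only [Set.mem_compl_iff, Set.mem_union, Set.mem_singleton_iff, not_or] at hx
  obtain ⟨hxK, hx0⟩ := hx
  rw [mem_posCone_iff hx0] at hxK
  obtain ⟨U, hU, hUK⟩ := mem_nhds_subtype _ _ _ |>.mp (hK.isOpen_compl.mem_nhds hxK)
  have hcont : ContinuousAt (fun y : 𝔼 n => ‖y‖⁻¹ • y) x :=
    (continuousAt_id.norm.inv₀ (norm_ne_zero_iff.mpr hx0)).smul continuousAt_id
  filter_upwards [hcont hU, isOpen_ne.mem_nhds hx0] with y hy hy0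
  simp only [Set.mem_compl_iff, Set.mem_union, Set.mem_singleton_iff, not_or]
  refine ⟨fun h => ?_, hy0⟩
  rw [mem_posCone_iff hy0] at h
  exact hUK (show toSph y hy0 ∈ Subtype.val ⁻¹' U from hy) h

theorem IsSphConvexBody.convex_posCone_union {K : Set (Sph n)} (hK : IsSphConvexBody K) :
    Convex ℝ (posCone K ∪ {0}) := by
  have hsmul : ∀ a : ℝ, 0 < a → ∀ x ∈ posCone K, a • x ∈ posCone K := by
    rintro a ha _ ⟨l, hl, u, hu, rfl⟩
    exact ⟨a * l, mul_pos ha hl, u, hu, smul_smul _ _ _⟩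
  intro x hx y hy a b ha hb hab
  rcases ha.eq_or_lt with rfl | ha
  · obtain rfl : b = 1 := by linarith
    simpa using hy
  rcases hb.eq_or_lt with rfl | hb
  · obtain rfl : a = 1 := by linarith
    simpa using hx
  rcases hx with hx | rfl
  · rcases hy with hy | rfl
    · exact Or.inl (hK.convex hx hy ha.le hb.le hab)
    · left
      simpa using hsmul a ha x hx
  · rcases hy with hy | rfl
    · left
      simpa using hsmul b hb y hy
    · right
      simp

/-- The bipolar theorem for spherical convex bodies. -/
theorem IsSphConvexBody.polar_polar {K : Set (Sph n)} (hK : IsSphConvexBody K) :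
    polar (polar K) = K := by
  refine Set.Subset.antisymm (fun x hx => ?_) fun x hx => mem_polar.mpr fun P hP => by
    rw [real_inner_comm]
    exact mem_polar.mp hP x hx
  by_contra hxK
  have hx0 : (x : 𝔼 n) ≠ 0 := ne_zero_of_mem_unit_sphere x
  have hxn : (x : 𝔼 n) ∉ posCone K ∪ {0} := by
    rintro (h | h)
    · obtain ⟨l, hl, u, hu, hxu⟩ := h
      have h1 := norm_sph x
      rw [hxu, norm_smul, norm_sph, mul_one, Real.norm_eq_abs, abs_of_pos hl] at h1
      rw [h1, one_smul] at hxu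
      exact hxK (Subtype.ext hxu ▸ hu)
    · exact hx0 h
  obtain ⟨f, u, hfu, hux⟩ := geometric_hahn_banach_closed_point hK.convex_posCone_union
    (isClosed_posCone_union hK.isClosed) hxn
  have hu0 : 0 < u := by simpa using hfu 0 (Or.inr rfl)
  -- A functional bounded above on a cone is nonpositive there.
  have hf : ∀ P ∈ K, f P ≤ 0 := by
    intro P hP
    by_contra! hpos
    have h1 := hfu ((u / f P) • (P : 𝔼 n)) (Or.inl ⟨_, div_pos hu0 hpos, P, hP, rfl⟩)
    rw [map_smul, smul_eq_mul, div_mul_cancel₀ _ hpos.ne'] at h1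
    exact lt_irrefl _ h1
  set y := (InnerProductSpace.toDual ℝ (𝔼 n)).symm f with hy
  have hyf : ∀ z : 𝔼 n, ⟪y, z⟫ = f z := fun z => InnerProductSpace.toDual_symm_apply
  have hfx : 0 < f x := hu0.trans hux
  have hyne : -y ≠ 0 := by
    intro h0
    rw [← hyf, neg_eq_zero.mp h0, inner_zero_left] at hfx
    exact lt_irrefl _ hfx
  have hmem : toSph (-y) hyne ∈ polar K := by
    rw [mem_polar]
    intro P hP
    rw [coe_toSph, real_inner_smul_left, inner_neg_left, hyf]
    exact mul_nonneg (by positivity) (by linarith [hf P hP])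
  have h1 := mem_polar.mp hx _ hmem
  rw [real_inner_comm, coe_toSph, real_inner_smul_left, inner_neg_left, hyf] at h1
  exact absurd h1 (not_le.mpr (mul_neg_of_pos_of_neg
    (inv_pos.mpr (norm_pos_iff.mpr hyne)) (by linarith)))

/-- A spherical convex body lies in an open hemisphere. -/
theorem IsSphConvexBody.exists_pos {K : Set (Sph n)} (hK : IsSphConvexBody K) :
    ∃ Q : Sph n, ∀ P ∈ K, 0 < ⟪(Q : 𝔼 n), (P : 𝔼 n)⟫ := by
  obtain ⟨y, -, hpos⟩ : ∃ y : 𝔼 n, (∀ P ∈ K, 0 ≤ ⟪y, (P : 𝔼 n)⟫) ∧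
      ∀ P ∈ K, P ∈ K → 0 < ⟪y, (P : 𝔼 n)⟫ := by
    -- Near each P some element of the polar is positive, since -P is not in K = K°°. Compactness
    -- lets finitely many of them be added up.
    refine hK.isClosed.isCompact.induction_on
      (p := fun S => ∃ y : 𝔼 n, (∀ P ∈ K, 0 ≤ ⟪y, (P : 𝔼 n)⟫) ∧
        ∀ P ∈ S, P ∈ K → 0 < ⟪y, (P : 𝔼 n)⟫) ⟨0, by simp⟩ ?_ ?_ ?_
    · rintro S T hST ⟨y, hy, hyT⟩
      exact ⟨y, hy, fun P hP => hyT P (hST hP)⟩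
    · rintro S T ⟨y, hy, hyS⟩ ⟨z, hz, hzT⟩
      refine ⟨y + z, fun P hP => ?_, fun P hP hPK => ?_⟩
      · rw [inner_add_left]
        exact add_nonneg (hy P hP) (hz P hP)
      · rw [inner_add_left]
        rcases hP with hP | hP
        · exact add_pos_of_pos_of_nonneg (hyS P hP hPK) (hz P hPK)
        · exact add_pos_of_nonneg_of_pos (hy P hPK) (hzT P hP hPK)
    · intro P hP
      have hneg : -P ∉ polar (polar K) := by
        rw [hK.polar_polar]
        intro hN
        refine ne_zero_of_mem_posCone (hK.convex (coe_mem_posCone hP) (coe_mem_posCone hN)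
          (a := 1 / 2) (b := 1 / 2) (by norm_num) (by norm_num) (by norm_num)) ?_
        rw [coe_neg_sphere, smul_neg, add_neg_cancel]
      rw [mem_polar] at hneg
      push Not at hneg
      obtain ⟨v, hv, hvP⟩ := hneg
      rw [coe_neg_sphere, inner_neg_left, real_inner_comm, neg_lt_zero] at hvP
      have hc : Continuous fun R : Sph n => ⟪(v : 𝔼 n), (R : 𝔼 n)⟫ := by fun_prop
      exact ⟨_, mem_nhdsWithin_of_mem_nhds (hc.continuousAt.eventually_const_lt hvP),
        v, mem_polar.mp hv, fun R hR _ => hR⟩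
  obtain ⟨P₀, hP₀⟩ := hK.nonempty_interior
  have hyne : y ≠ 0 := by
    intro h0
    have h1 := hpos P₀ (interior_subset hP₀) (interior_subset hP₀)
    rw [h0, inner_zero_left] at h1
    exact lt_irrefl _ h1
  refine ⟨toSph y hyne, fun P hP => ?_⟩
  rw [coe_toSph, real_inner_smul_left]
  exact mul_pos (inv_pos.mpr (norm_pos_iff.mpr hyne)) (hpos P hP hP)

theorem mem_interior_polar {K : Set (Sph n)} (hK : IsClosed K) {Q : Sph n}
    (hQ : ∀ P ∈ K, 0 < ⟪(Q : 𝔼 n), (P : 𝔼 n)⟫) : Q ∈ interior (polar K) := by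
  rw [mem_interior_iff_mem_nhds]
  have h1 : ∀ᶠ R : Sph n in nhds Q, ∀ P ∈ K, 0 < ⟪(R : 𝔼 n), (P : 𝔼 n)⟫ := by
    refine hK.isCompact.eventually_forall_of_forall_eventually fun P hP => ?_
    have hc : Continuous fun z : Sph n × Sph n => ⟪(z.1 : 𝔼 n), (z.2 : 𝔼 n)⟫ := by fun_prop
    exact hc.continuousAt.eventually_const_lt (hQ P hP)
  filter_upwards [h1] with R hR
  exact mem_polar.mpr fun P hP => (hR P hP).le

theorem IsSphConvexBody.polar {K : Set (Sph n)} (hK : IsSphConvexBody K) :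
    IsSphConvexBody (polar K) := by
  obtain ⟨P₀, hP₀⟩ := hK.nonempty_interior
  obtain ⟨Q, hQ⟩ := hK.exists_pos
  refine ⟨isClosed_polar K, ?_, ⟨Q, mem_interior_polar hK.isClosed hQ⟩⟩
  rintro _ ⟨l, hl, u, hu, rfl⟩ _ ⟨l', hl', u', hu', rfl⟩ a b ha hb hab
  -- An interior point of `K` is positive on the whole polar, so no cancellation to zero occurs.
  have hne : a • l • (u : 𝔼 n) + b • l' • (u' : 𝔼 n) ≠ 0 := by
    intro h0
    have h1 : ⟪(P₀ : 𝔼 n), a • l • (u : 𝔼 n) + b • l' • (u' : 𝔼 n)⟫ = 0 := by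
      rw [h0, inner_zero_right]
    simp only [inner_add_right, real_inner_smul_right] at h1
    have h2 := mul_pos hl (pos_of_mem_interior hP₀ hu)
    have h3 := mul_pos hl' (pos_of_mem_interior hP₀ hu')
    rcases ha.eq_or_lt with rfl | ha
    · obtain rfl : b = 1 := by linarith
      linarith
    · nlinarith [mul_pos ha h2, mul_nonneg hb h3.le]
  rw [mem_posCone_iff hne, mem_polar]
  intro P hP
  rw [coe_toSph]
  simp only [real_inner_smul_left, inner_add_left]
  have := mem_polar.mp hu P hP
  have := mem_polar.mp hu' P hP
  positivity

theorem IsSphConvexBody.isPolarOf {K : Set (Sph n)} (hK : IsSphConvexBody K) :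
    IsPolarOf (((↑) : Sph n → 𝔼 n) '' K) ((↑) '' SphGeom.polar K) := by
  obtain ⟨P₀, hP₀⟩ := hK.nonempty_interior
  refine ⟨hK.isClosed.isCompact.image continuous_subtype_val, ?_, ?_, ?_, P₀,
    ⟨P₀, interior_subset hP₀, rfl⟩, ?_⟩
  · rintro _ ⟨P, -, rfl⟩
    exact norm_sph P
  · rintro _ ⟨P, hP, rfl⟩ _ ⟨Q, hQ, rfl⟩
    rw [real_inner_comm]
    exact mem_polar.mp hQ P hP
  · intro x hx hpos
    refine ⟨⟨x, by simpa using hx⟩, ?_, rfl⟩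
    rw [← hK.polar_polar, mem_polar]
    exact fun Q hQ => hpos _ ⟨Q, hQ, rfl⟩
  · rintro _ ⟨Q, hQ, rfl⟩
    exact pos_of_mem_interior hP₀ hQ

theorem IsSphConvexBody.polarPair {K : Set (Sph n)} (hK : IsSphConvexBody K) :
    PolarPair (((↑) : Sph n → 𝔼 n) '' K) ((↑) '' SphGeom.polar K) :=
  ⟨hK.isPolarOf, by simpa only [hK.polar_polar] using hK.polar.isPolarOf⟩

/-! ### Widths as minima of inner products over the polar. -/

theorem isSupporting_iff {K : Set (Sph n)} (hK : IsClosed K) {P : Sph n} :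
    IsSupporting K P ↔ P ∈ polar K ∧ ∃ Q ∈ K, ⟪(P : 𝔼 n), (Q : 𝔼 n)⟫ = 0 := by
  constructor
  · rintro ⟨Q, hP, hQ, hPQ⟩
    exact ⟨subset_hemisphere_iff.mp hP, Q, hK.frontier_subset hQ, hPQ⟩
  · rintro ⟨hP, Q, hQ, hPQ⟩
    refine ⟨Q, subset_hemisphere_iff.mpr hP, ⟨subset_closure hQ, fun hint => ?_⟩, hPQ⟩
    have := pos_of_mem_interior hint hP
    rw [real_inner_comm, hPQ] at this
    exact lt_irrefl _ this

theorem inner_mem_Icc (P Q : Sph n) : ⟪(P : 𝔼 n), (Q : 𝔼 n)⟫ ∈ Set.Icc (-1 : ℝ) 1 := by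
  have := abs_real_inner_le_norm (P : 𝔼 n) (Q : 𝔼 n)
  rw [norm_sph, norm_sph, mul_one] at this
  exact abs_le.mp this

theorem cos_luneThickness (P Q : Sph n) :
    Real.cos (luneThickness P Q) = -⟪(P : 𝔼 n), (Q : 𝔼 n)⟫ := by
  rw [luneThickness, sdist, Real.cos_pi_sub,
    Real.cos_arccos (inner_mem_Icc P Q).1 (inner_mem_Icc P Q).2]

theorem luneThickness_mem_Icc (P Q : Sph n) : luneThickness P Q ∈ Set.Icc 0 Real.pi := by
  rw [luneThickness, sdist]
  exact ⟨by linarith [Real.arccos_le_pi ⟪(P : 𝔼 n), (Q : 𝔼 n)⟫],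
    by linarith [Real.arccos_nonneg ⟪(P : 𝔼 n), (Q : 𝔼 n)⟫]⟩

/-- Cosine reverses order on [0, π]. The lune condition is harmless: Q = P gives inner product 1 >
-cos τ, and Q = -P cannot occur in the polar. -/
theorem IsSphConvexBody.isWidth_iff {K : Set (Sph n)} (hK : IsSphConvexBody K) {P : Sph n}
    (hP : P ∈ SphGeom.polar K) {τ : ℝ} (hτ0 : 0 < τ) (hτπ : τ < Real.pi) :
    IsWidth K P τ ↔ (∀ Q ∈ SphGeom.polar K, -Real.cos τ ≤ ⟪(P : 𝔼 n), (Q : 𝔼 n)⟫) ∧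
      ∃ Q ∈ SphGeom.polar K, ⟪(P : 𝔼 n), (Q : 𝔼 n)⟫ = -Real.cos τ := by
  have hτ : τ ∈ Set.Icc 0 Real.pi := ⟨hτ0.le, hτπ.le⟩
  have hself : ⟪(P : 𝔼 n), (P : 𝔼 n)⟫ = 1 := by
    rw [real_inner_self_eq_norm_sq, norm_sph, one_pow]
  have hcos : Real.cos τ < 1 := by
    simpa using Real.cos_lt_cos_of_nonneg_of_le_pi le_rfl hτπ.le hτ0
  have hcos' : -1 < Real.cos τ := by
    simpa using Real.cos_lt_cos_of_nonneg_of_le_pi hτ0.le le_rfl hτπ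
  have hanti : ∀ Q ∈ SphGeom.polar K, P ≠ -Q := by
    rintro Q hQ rfl
    have := hK.polarPair.symm.neg_one_lt_inner ⟨_, hP, rfl⟩ ⟨_, hQ, rfl⟩
    rw [coe_neg_sphere, inner_neg_left, real_inner_self_eq_norm_sq, norm_sph] at this
    norm_num at this
  constructor
  · rintro ⟨⟨Q, -, hQ, hτQ⟩, hleast⟩
    refine ⟨fun R hR => ?_, Q, subset_hemisphere_iff.mp hQ, ?_⟩
    · by_cases hPR : P = R
      · rw [← hPR, hself]
        linarith
      · have h1 : τ ≤ luneThickness P R :=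
          hleast ⟨R, ⟨hPR, hanti R hR⟩, subset_hemisphere_iff.mpr hR, rfl⟩
        have h2 := Real.cos_le_cos_of_nonneg_of_le_pi hτ0.le (luneThickness_mem_Icc P R).2 h1
        rw [cos_luneThickness] at h2
        linarith
    · rw [hτQ, cos_luneThickness, neg_neg]
  · rintro ⟨hle, Q, hQ, hPQ⟩
    refine ⟨⟨Q, ⟨?_, hanti Q hQ⟩, subset_hemisphere_iff.mpr hQ, ?_⟩, ?_⟩
    · rintro rfl
      linarith
    · exact Real.injOn_cos hτ (luneThickness_mem_Icc P Q) (by rw [cos_luneThickness, hPQ, neg_neg])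
    · rintro _ ⟨R, -, hR, rfl⟩
      rw [← Real.strictAntiOn_cos.le_iff_ge (luneThickness_mem_Icc P R) hτ, cos_luneThickness]
      linarith [hle R (subset_hemisphere_iff.mp hR)]

theorem IsSphConvexBody.isConstantWidth_iff {K : Set (Sph n)} (hK : IsSphConvexBody K) {τ : ℝ}
    (hτ0 : 0 < τ) (hτπ : τ < Real.pi) :
    IsConstantWidth K τ ↔ BoundaryMin (((↑) : Sph n → 𝔼 n) '' SphGeom.polar K) ((↑) '' K)
      (-Real.cos τ) := by
  simp only [IsConstantWidth, hK, true_and, isSupporting_iff hK.isClosed, BoundaryMin,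
    Set.forall_mem_image, Set.exists_mem_image]
  constructor
  · intro h P hP Q hQ hPQ
    exact (hK.isWidth_iff hP hτ0 hτπ).mp (h P ⟨hP, Q, hQ, hPQ⟩)
  · rintro h P ⟨hP, Q, hQ, hPQ⟩
    exact (hK.isWidth_iff hP hτ0 hτπ).mpr (h hP hQ hPQ)

end Bodies

end SphGeom

theorem lemma2p3 (n : ℕ) (C : Set (SphGeom.Sph n)) (hC : SphGeom.IsSphConvexBody C)
    (τ : ℝ) (hτ0 : 0 < τ) (hτπ : τ < Real.pi) :
    SphGeom.IsConstantWidth C τ ↔ SphGeom.IsConstantWidth (SphGeom.polar C) (Real.pi - τ) := by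
  have hcos : Real.cos τ < 1 := by
    simpa using Real.cos_lt_cos_of_nonneg_of_le_pi le_rfl hτπ.le hτ0
  have hcos' : -1 < Real.cos τ := by
    simpa using Real.cos_lt_cos_of_nonneg_of_le_pi hτ0.le le_rfl hτπ
  rw [hC.isConstantWidth_iff hτ0 hτπ,
    hC.polar.isConstantWidth_iff (by linarith) (by linarith), hC.polar_polar, Real.cos_pi_sub,
    neg_neg]
  exact (hC.polarPair.boundaryMin_iff hcos' hcos).symm
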